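/- Let $k$ be an algebraically closed field of characteristic $p>0$ and let $\mathbb{G}_a$ be the additive group of $k$. A representation $u:\mathbb{G}_a\to\mathrm{SL}(3,k)$ (a morphism of affine $k$-varieties that is a group homomorphism) is called fundamental if there is a representation of algebraic groups $\psi:\mathrm{SL}(2,k)\to\mathrm{SL}(3,k)$ with $\psi\begin{pmatrix}1&t\\0&1\end{pmatrix}=u(t)$ for all $t\in k$. Two maps $u,v:\mathbb{G}_a\to\mathrm{SL}(3,k)$ are called equivalent if there is $P\in\mathrm{GL}(3,k)$ with $P^{-1}u(t)P=v(t)$ for all $t\in k$. Let $u:\mathbb{G}_a\to\mathrm{SL}(3,k)$ be a morphism of affine $k$-varieties. (1) If $p=2$, then each of the following maps $u^\sharp$ is a fundamental representation, and $u$ is a fundamental representation if and only if $u$ is equivalent to one of them: $$u^\sharp(t)=\begin{pmatrix}1&0&t^{p^e}\\0&1&0\\0&0&1\end{pmatrix}\ (e\ge0),\qquad u^\sharp(t)=\begin{pmatrix}1&t^{p^e}&t^{2p^e}\\0&1&0\\0&0&1\end{pmatrix}\ (e\ge0),$$ $$u^\sharp(t)=\begin{pmatrix}1&0&t^{2p^e}\\0&1&t^{p^e}\\0&0&1\end{pmatrix}\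 (e\ge0),\qquad u^\sharp(t)=I_3.$$ (2) If $p\ge3$, then each of the following maps $u^\sharp$ is a fundamental representation, and $u$ is a fundamental representation if and only if $u$ is equivalent to one of them: $$u^\sharp(t)=\begin{pmatrix}1&t^{p^e}&\tfrac12t^{2p^e}\\0&1&t^{p^e}\\0&0&1\end{pmatrix}\ (e\ge0),\qquad u^\sharp(t)=\begin{pmatrix}1&0&t^{p^e}\\0&1&0\\0&0&1\end{pmatrix}\ (e\ge0),\qquad u^\sharp(t)=I_3.$$ Here $e$ ranges over the non-negative integers. -/

import Mathlib

/- Over an algebraically closed field `k` a variety is identified with its set of `k`-points: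
`𝔾ₐ` is the additive group of `k`, and `SL(n, k)` is Mathlib's special linear group, a closed
subvariety of the affine space of matrices. A morphism into `SL(n, k)` is thus a map all of whose
matrix entries are regular functions, i.e. polynomials in the coordinates of the source. -/

/-- `u : 𝔾ₐ → SL(n, k)` is a morphism of affine varieties: every matrix entry of `u t` is a
polynomial in `t`. -/
def IsGaMorphism {k : Type*} [Field k] {n : ℕ}
    (u : k → Matrix.SpecialLinearGroup (Fin n) k) : Prop :=
  ∀ i j : Fin n, ∃ f : Polynomial k, ∀ t : k,
    (u t : Matrix (Fin n) (Fin n) k) i j = f.eval t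

/-- `u : 𝔾ₐ → SL(n, k)` is a representation of the algebraic group `𝔾ₐ`: a morphism of varieties
that is a group homomorphism. -/
def IsGaRepresentation {k : Type*} [Field k] {n : ℕ}
    (u : k → Matrix.SpecialLinearGroup (Fin n) k) : Prop :=
  IsGaMorphism u ∧ ∀ s t : k, u (s + t) = u s * u t

/-- The group homomorphism `ψ : SL(2, k) → SL(n, k)` is a representation of the algebraic group
`SL(2, k)`: every matrix entry of `ψ g` is a polynomial in the four entries of `g`. -/
def IsSL2Representation {k : Type*} [Field k] {n : ℕ}
    (ψ : Matrix.SpecialLinearGroup (Fin 2) k →* Matrix.SpecialLinearGroup (Fin n) k) : Prop :=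
  ∀ i j : Fin n, ∃ f : MvPolynomial (Fin 2 × Fin 2) k,
    ∀ g : Matrix.SpecialLinearGroup (Fin 2) k,
      (ψ g : Matrix (Fin n) (Fin n) k) i j =
        MvPolynomial.eval (fun x => (g : Matrix (Fin 2) (Fin 2) k) x.1 x.2) f

/-- The inclusion `ι⁺ : 𝔾ₐ → SL(2, k)`. -/
def iotaPlus {k : Type*} [Field k] (t : k) : Matrix.SpecialLinearGroup (Fin 2) k :=
  ⟨!![1, t; 0, 1], by simp [Matrix.det_fin_two]⟩

/-- `u` is a fundamental representation of `𝔾ₐ`: a representation that extends along `ι⁺` to a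
representation of `SL(2, k)`. -/
def IsFundamental {k : Type*} [Field k] {n : ℕ}
    (u : k → Matrix.SpecialLinearGroup (Fin n) k) : Prop :=
  IsGaRepresentation u ∧
    ∃ ψ : Matrix.SpecialLinearGroup (Fin 2) k →* Matrix.SpecialLinearGroup (Fin n) k,
      IsSL2Representation ψ ∧ ∀ t : k, ψ (iotaPlus t) = u t

/-- Equivalence of maps into `SL(n, k)`: conjugation by one matrix of `GL(n, k)`. -/
def AreEquivalent {k : Type*} [Field k] {n : ℕ}
    (u v : k → Matrix.SpecialLinearGroup (Fin n) k) : Prop :=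
  ∃ P : Matrix.GeneralLinearGroup (Fin n) k, ∀ t : k,
    ((P⁻¹ : Matrix.GeneralLinearGroup (Fin n) k) : Matrix (Fin n) (Fin n) k) *
      (u t : Matrix (Fin n) (Fin n) k) * (P : Matrix (Fin n) (Fin n) k) =
        (v t : Matrix (Fin n) (Fin n) k)

/-- The list of forms in characteristic `p = 2`. -/
def HasFormCharTwo {k : Type*} [Field k] (p : ℕ)
    (v : k → Matrix.SpecialLinearGroup (Fin 3) k) : Prop :=
  (∃ e : ℕ, ∀ t : k, (v t : Matrix (Fin 3) (Fin 3) k) =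
    !![1, 0, t ^ p ^ e;
       0, 1, 0;
       0, 0, 1]) ∨
  (∃ e : ℕ, ∀ t : k, (v t : Matrix (Fin 3) (Fin 3) k) =
    !![1, t ^ p ^ e, t ^ (2 * p ^ e);
       0, 1, 0;
       0, 0, 1]) ∨
  (∃ e : ℕ, ∀ t : k, (v t : Matrix (Fin 3) (Fin 3) k) =
    !![1, 0, t ^ (2 * p ^ e);
       0, 1, t ^ p ^ e;
       0, 0, 1]) ∨
  (∀ t : k, (v t : Matrix (Fin 3) (Fin 3) k) =
    !![1, 0, 0;
       0, 1, 0;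
       0, 0, 1])

/-- The list of forms in characteristic `p ≥ 3`. -/
def HasFormCharOdd {k : Type*} [Field k] (p : ℕ)
    (v : k → Matrix.SpecialLinearGroup (Fin 3) k) : Prop :=
  (∃ e : ℕ, ∀ t : k, (v t : Matrix (Fin 3) (Fin 3) k) =
    !![1, t ^ p ^ e, (1 / 2 : k) * t ^ (2 * p ^ e);
       0, 1, t ^ p ^ e;
       0, 0, 1]) ∨
  (∃ e : ℕ, ∀ t : k, (v t : Matrix (Fin 3) (Fin 3) k) =
    !![1, 0, t ^ p ^ e;
       0, 1, 0;
       0, 0, 1]) ∨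
  (∀ t : k, (v t : Matrix (Fin 3) (Fin 3) k) =
    !![1, 0, 0;
       0, 1, 0;
       0, 0, 1])

/-! Everything comes from the torus of SL(2). Let `ψ` extend `u`. The operators `ψ(diag(z, z⁻¹))`
are simultaneously diagonalizable with eigenvalues `z ^ a i` (`exists_diagonalization`). The weights
`a i` sum to zero by the determinant and are stable under negation by the Weyl element, so after a
permutation they are `m, 0, -m`. The torus rescales the parameter of `ι⁺` by `z²`, so entry `(i, j)`
of `u` is zero or a monomial of degree `(a i - a j) / 2` (`entry_eq_monomial_of_torus_diagonal`).
Hence `u` is unitriangular, with entries `α t^r`, `β t^r` next to the diagonal and `γ t^m` in the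
corner, where `m = 2r` unless `α = β = 0`.

Additivity does the rest: an additive monomial has degree `p^e`, and if `α`, `β` are not both zero
then `2γ = αβ`. For `p = 2` this kills `α` or `β` and leaves `γ` free; for odd `p` it determines
`γ`. Diagonal rescaling and permutation of the basis give the lists.

Conversely, the forms are restrictions of Frobenius twists of the standard representation plus a
trivial one, the symmetric square and the divided square. The divided square of `A` is the transpose
of the symmetric square of `Aᵀ`; the two become inequivalent in characteristic 2, whence two
separate forms there. -/

section

open Matrix Polynomial

/-! ### Polynomial identities and diagonalization of a torus -/

theorem Polynomial.eq_of_eval_eq_of_ne_zero {k : Type*} [Field k] [Infinite k] {f g : k[X]}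
    (h : ∀ z : k, z ≠ 0 → f.eval z = g.eval z) : f = g := by
  have : f * X = g * X := by
    refine Polynomial.funext fun z => ?_
    by_cases hz : z = 0
    · simp [hz]
    · simp [h z hz]
  exact mul_right_cancel₀ X_ne_zero this

/-- Used to turn identities between characters of the torus into identities between integer weights.
-/
theorem eq_zero_of_forall_zpow_eq_one {k : Type*} [Field k] [Infinite k] {n : ℤ}
    (h : ∀ z : k, z ≠ 0 → z ^ n = 1) : n = 0 := by
  have key : ∀ m : ℕ, (∀ z : k, z ≠ 0 → z ^ m = 1) → m = 0 := fun m hm => by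
    have : (X ^ m : k[X]) = 1 :=
      Polynomial.eq_of_eval_eq_of_ne_zero fun z hz => by simp [hm z hz]
    simpa using congrArg natDegree this
  have := key n.natAbs fun z hz => by
    rcases Int.natAbs_eq n with hn | hn
    · rw [← zpow_natCast, ← hn, h z hz]
    · rw [← zpow_natCast, ← neg_eq_iff_eq_neg.mpr hn, _root_.zpow_neg, h z hz, inv_one]
  omega

/-- A polynomial matrix whose suitable rescaling is multiplicative on the units is diagonalizable,
with Laurent monomials as eigenvalues. -/
theorem exists_diagonalization {k : Type*} [Field k] [Infinite k] {n : ℕ}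
    (D : kˣ →* Matrix (Fin n) (Fin n) k) (N : ℕ) (F : Fin n → Fin n → k[X])
    (hF : ∀ (z : kˣ) i j, (z : k) ^ N * D z i j = (F i j).eval (z : k)) :
    ∃ (P : GL (Fin n) k) (a : Fin n → ℤ), ∀ z : kˣ,
      D z * (P : Matrix (Fin n) (Fin n) k) =
        (P : Matrix (Fin n) (Fin n) k) * diagonal fun i => (z : k) ^ a i := by
  -- The coefficient matrices in `z ^ N • D z = ∑ z ^ m • A m`.
  let A : ℕ → Matrix (Fin n) (Fin n) k := fun m => Matrix.of fun i j => (F i j).coeff m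
  have hA : ∀ (z : kˣ) m, D z * A m = (z : k) ^ ((m : ℤ) - N) • A m := by
    intro z m
    ext i j
    -- This is `D z * D w = D (z * w)` as a polynomial identity in `w`; comparing coefficients of `w
    -- ^ m` makes every column of `A m` an eigenvector of weight `m - N`.
    have hp : ∑ l, C ((z : k) ^ N * D z i l) * F l j = (F i j).comp (C (z : k) * X) := by
      refine Polynomial.eq_of_eval_eq_of_ne_zero fun w hw => ?_
      obtain ⟨w, rfl⟩ := hw.isUnit
      have h1 := hF (z * w) i j
      rw [map_mul, Matrix.mul_apply] at h1
      simp only [eval_finsetSum, eval_mul, eval_C, eval_comp, eval_X, ← hF w]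
      rw [← Units.val_mul, ← h1, Finset.mul_sum]
      refine Finset.sum_congr rfl fun l _ => ?_
      push_cast
      ring
    have hc := congrArg (fun q => q.coeff m) hp
    simp only [finsetSum_coeff, coeff_C_mul, comp_C_mul_X_coeff] at hc
    have hz : (z : k) ^ N ≠ 0 := pow_ne_zero _ z.ne_zero
    apply mul_left_cancel₀ hz
    rw [Matrix.mul_apply, Finset.mul_sum, Matrix.smul_apply, smul_eq_mul, ← mul_assoc,
      zpow_sub₀ z.ne_zero, zpow_natCast, zpow_natCast, mul_div_cancel₀ _ hz, mul_comm _ (A m i j)]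
    simp only [A, Matrix.of_apply, ← mul_assoc]
    exact hc
  obtain ⟨M, hM⟩ : ∃ M, ∀ i j, (F i j).natDegree < M := by
    refine ⟨(∑ i, ∑ j, (F i j).natDegree) + 1, fun i j => Nat.lt_succ_of_le ?_⟩
    exact (Finset.single_le_sum (f := fun j => (F i j).natDegree) (fun _ _ => Nat.zero_le _)
      (Finset.mem_univ j)).trans (Finset.single_le_sum (f := fun i => ∑ j, (F i j).natDegree)
      (fun _ _ => Nat.zero_le _) (Finset.mem_univ i))
  have hsum : ∑ m ∈ Finset.range M, A m = 1 := by
    ext i j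
    have := hF 1 i j
    rw [eval_eq_sum_range' (hM i j)] at this
    simp only [Units.val_one, one_pow, one_mul, mul_one, map_one] at this
    rw [this, Matrix.sum_apply]
    rfl
  -- The common eigenvectors span, since `v = ∑ A m *ᵥ v` by `hsum`; a basis can therefore be chosen
  -- among them.
  let S : Set (Fin n → k) := {v | ∃ a : ℤ, ∀ z : kˣ, D z *ᵥ v = (z : k) ^ a • v}
  have hS : ⊤ ≤ Submodule.span k S := by
    intro v _
    rw [← Matrix.one_mulVec v, ← hsum, Matrix.sum_mulVec]
    refine Submodule.sum_mem _ fun m _ => Submodule.subset_span ⟨(m : ℤ) - N, fun z => ?_⟩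
    rw [Matrix.mulVec_mulVec, hA, Matrix.smul_mulVec]
  let B := Module.Basis.ofSpan hS
  have : Fintype (LinearIndepOn.extend (linearIndepOn_empty k id) (Set.empty_subset S)) :=
    FiniteDimensional.fintypeBasisIndex B
  let b : Module.Basis (Fin n) k (Fin n → k) := B.reindex (Fintype.equivFinOfCardEq (by
    rw [← Module.finrank_eq_card_basis B, Module.finrank_fin_fun]))
  have hb : ∀ i, b i ∈ S := fun i => by
    rw [Module.Basis.reindex_apply]
    exact Module.Basis.ofSpan_subset hS ⟨_, rfl⟩
  choose a ha using hb
  let P : Matrix (Fin n) (Fin n) k := Matrix.of fun i j => b j i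
  have hP : IsUnit P := Matrix.linearIndependent_cols_iff_isUnit.mp b.linearIndependent
  obtain ⟨P', hP'⟩ := hP
  refine ⟨P', a, fun z => ?_⟩
  rw [hP']
  ext i j
  have := congrFun (ha j z) i
  rw [Matrix.mul_diagonal, mul_comm]
  exact this

/-- Only the lower diagonal variable contributes a factor `z⁻¹`, absorbed by raising `N` by one. -/
theorem exists_pow_mul_eval_torus {k : Type*} [Field k] (f : MvPolynomial (Fin 2 × Fin 2) k) :
    ∃ (N : ℕ) (g : k[X]), ∀ z : k, z ≠ 0 →
      z ^ N * MvPolynomial.eval (fun x => !![z, 0; 0, z⁻¹] x.1 x.2) f = g.eval z := by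
  induction f using MvPolynomial.induction_on with
  | C a => exact ⟨0, C a, fun z _ => by simp⟩
  | add f g hf hg =>
    obtain ⟨N, f', hf⟩ := hf
    obtain ⟨M, g', hg⟩ := hg
    refine ⟨N + M, X ^ M * f' + X ^ N * g', fun z hz => ?_⟩
    simp only [map_add, eval_add, eval_mul, eval_pow, eval_X, ← hf z hz, ← hg z hz]
    ring
  | mul_X f x hf =>
    obtain ⟨N, f', hf⟩ := hf
    obtain ⟨i, j⟩ := x
    fin_cases i <;> fin_cases j
    · refine ⟨N, f' * X, fun z hz => ?_⟩
      simp [← hf z hz, mul_assoc]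
    · exact ⟨0, 0, fun z hz => by simp⟩
    · exact ⟨0, 0, fun z hz => by simp⟩
    · refine ⟨N + 1, f', fun z hz => ?_⟩
      rw [← hf z hz, map_mul, MvPolynomial.eval_X, pow_succ]
      generalize MvPolynomial.eval _ f = y
      change z ^ N * z * (y * z⁻¹) = _
      field_simp

/-- A polynomial that is homogeneous for the action of squares is a monomial of half the weight. -/
theorem Polynomial.eq_monomial_of_sq_homogeneous {k : Type*} [Field k] [IsAlgClosed k] {f : k[X]}
    {d : ℤ} (h : ∀ z : k, z ≠ 0 → f.eval (z ^ 2) = z ^ d * f.eval 1) :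
    f = 0 ∨ ∃ (r : ℕ) (c : k), d = 2 * r ∧ f = C c * X ^ r := by
  have : Infinite k := IsAlgClosed.instInfinite
  by_cases hc : f.eval 1 = 0
  · left
    refine Polynomial.eq_of_eval_eq_of_ne_zero fun s hs => ?_
    -- Every point is a square, so homogeneity propagates the zero at `1` everywhere.
    obtain ⟨z, rfl⟩ := IsAlgClosed.exists_pow_nat_eq s (n := 2) (by norm_num)
    rw [h z (by rintro rfl; simp at hs), hc]
    simp
  right
  obtain ⟨n, rfl | rfl⟩ := d.eq_nat_or_neg
  -- `expand k 2 f` is `f(X²)`; comparing degrees shows that the weight is even.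
  · have he : expand k 2 f = C (f.eval 1) * X ^ n :=
      Polynomial.eq_of_eval_eq_of_ne_zero fun z hz => by
        rw [expand_eval, h z hz, eval_mul, eval_C, eval_pow, eval_X, zpow_natCast, mul_comm]
    have hn : f.natDegree * 2 = n := by
      have := congrArg natDegree he
      rwa [natDegree_expand, natDegree_C_mul_X_pow _ _ hc] at this
    refine ⟨f.natDegree, f.eval 1, by rw [← hn]; push_cast; ring, ?_⟩
    apply expand_injective (R := k) (n := 2) (by norm_num)
    rw [he]
    rw [map_mul, map_pow, expand_C, expand_X, ← pow_mul, ← hn, mul_comm 2]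
  · have he : X ^ n * expand k 2 f = C (f.eval 1) :=
      Polynomial.eq_of_eval_eq_of_ne_zero fun z hz => by
        have hz' := pow_ne_zero n hz
        simp only [eval_mul, eval_pow, eval_X, expand_eval, h z hz, eval_C, _root_.zpow_neg, zpow_natCast]
        field_simp
    -- A positive `n` would make the left side of `he` vanish at `0`, but the right side is a
    -- nonzero constant.
    have hn : n = 0 := by
      by_contra hn
      have := congrArg (eval 0) he
      simp [hn] at this
      exact hc this.symm
    subst hn
    refine ⟨0, f.eval 1, by simp, ?_⟩
    apply expand_injective (R := k) (n := 2) (by norm_num)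
    simpa using he

/-- Write `n = p ^ e * q` with `p ∤ q`. Injectivity of Frobenius reduces the identity to `(X + 1) ^
q = X ^ q + 1`, whose linear coefficient `q` is nonzero in `k`, so `q = 1`. -/
theorem eq_prime_pow_of_pow_add {k : Type*} [Field k] [Infinite k] {p : ℕ} (hp : p.Prime)
    [CharP k p] {n : ℕ} (h : ∀ s t : k, (s + t) ^ n = s ^ n + t ^ n) : ∃ e, n = p ^ e := by
  have : Fact p.Prime := ⟨hp⟩
  have hn0 : n ≠ 0 := by
    rintro rfl
    simpa using h 0 0
  obtain ⟨e, q, hq, rfl⟩ := Nat.exists_eq_pow_mul_and_not_dvd hn0 p hp.ne_one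
  have h1 : (X + 1 : k[X]) ^ q = X ^ q + 1 := Polynomial.funext fun s => by
    apply (iterateFrobenius k p e).injective
    have := h s 1
    simp only [eval_add, eval_pow, eval_X, eval_one, iterateFrobenius_def, add_pow_char_pow,
      one_pow, ← pow_mul]
    rw [mul_comm q, this, one_pow]
  have h2 := congrArg (fun f => f.coeff 1) h1
  simp only [coeff_X_add_one_pow, Nat.choose_one_right, coeff_add, coeff_X_pow, coeff_one] at h2
  refine ⟨e, ?_⟩
  by_cases hq1 : q = 1
  · rw [hq1, mul_one]
  · simp [Ne.symm hq1] at h2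
    exact absurd ((CharP.cast_eq_zero_iff k p q).mp h2) hq

end

section

open Matrix
open Polynomial (evalRingHom coe_evalRingHom)

/-! ### Conjugation, Frobenius twists and restriction along `ι⁺` -/

theorem Units.conj_mul_conj {M : Type*} [Monoid M] (P : Mˣ) (A B : M) :
    ↑P⁻¹ * (A * B) * ↑P = (↑P⁻¹ * A * ↑P) * (↑P⁻¹ * B * ↑P) := by
  simp only [mul_assoc, Units.mul_inv_cancel_left]

theorem det_units_conj_eq {k : Type*} [Field k] {n : ℕ} (P : GL (Fin n) k)
    (A : Matrix (Fin n) (Fin n) k) :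
    ((P⁻¹ : GL (Fin n) k) * A * (P : GL (Fin n) k) : Matrix (Fin n) (Fin n) k).det = A.det := by
  rw [det_mul, det_mul, mul_right_comm, ← det_mul, ← Units.val_mul]
  simp

/-- Conjugation by `P⁻¹` on the special linear group. -/
def conjGL {k : Type*} [Field k] {n : ℕ} (P : GL (Fin n) k) :
    SpecialLinearGroup (Fin n) k →* SpecialLinearGroup (Fin n) k :=
  MonoidHom.mk' (fun g =>
    ⟨(P⁻¹ : GL (Fin n) k) * (g : Matrix (Fin n) (Fin n) k) * (P : GL (Fin n) k),
      (det_units_conj_eq P _).trans g.det_coe⟩)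
    fun _ _ => Subtype.ext (Units.conj_mul_conj P _ _)

theorem coe_conjGL {k : Type*} [Field k] {n : ℕ} (P : GL (Fin n) k)
    (g : SpecialLinearGroup (Fin n) k) : (conjGL P g : Matrix (Fin n) (Fin n) k) =
      (P⁻¹ : GL (Fin n) k) * (g : Matrix (Fin n) (Fin n) k) * (P : GL (Fin n) k) := rfl

theorem conjGL_mul {k : Type*} [Field k] {n : ℕ} (P Q : GL (Fin n) k)
    (g : SpecialLinearGroup (Fin n) k) : conjGL (P * Q) g = conjGL Q (conjGL P g) := by
  refine Subtype.ext ?_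
  simp [coe_conjGL, mul_assoc]

theorem conjGL_inv_conjGL {k : Type*} [Field k] {n : ℕ} (P : GL (Fin n) k)
    (g : SpecialLinearGroup (Fin n) k) : conjGL P⁻¹ (conjGL P g) = g := by
  rw [← conjGL_mul, mul_inv_cancel]
  refine Subtype.ext ?_
  simp [coe_conjGL]

theorem areEquivalent_iff {k : Type*} [Field k] {n : ℕ}
    {u v : k → SpecialLinearGroup (Fin n) k} :
    AreEquivalent u v ↔ ∃ P, ∀ t, conjGL P (u t) = v t := by
  exact exists_congr fun P => forall_congr' fun t =>
    ⟨fun h => Subtype.ext h, fun h => congrArg Subtype.val h⟩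

theorem AreEquivalent.trans {k : Type*} [Field k] {n : ℕ}
    {u v w : k → SpecialLinearGroup (Fin n) k} (h : AreEquivalent u v) (h' : AreEquivalent v w) :
    AreEquivalent u w := by
  rw [areEquivalent_iff] at *
  obtain ⟨P, hP⟩ := h
  obtain ⟨Q, hQ⟩ := h'
  exact ⟨P * Q, fun t => by rw [conjGL_mul, hP, hQ]⟩

theorem AreEquivalent.symm {k : Type*} [Field k] {n : ℕ}
    {u v : k → SpecialLinearGroup (Fin n) k} (h : AreEquivalent u v) : AreEquivalent v u := by
  rw [areEquivalent_iff] at *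
  obtain ⟨P, hP⟩ := h
  exact ⟨P⁻¹, fun t => by rw [← hP, conjGL_inv_conjGL]⟩

theorem areEquivalent_of_mul_eq {k : Type*} [Field k] {n : ℕ}
    {u v : k → SpecialLinearGroup (Fin n) k} (P : Matrix (Fin n) (Fin n) k) (hP : P.det ≠ 0)
    (h : ∀ t, (u t : Matrix (Fin n) (Fin n) k) * P = P * (v t : Matrix (Fin n) (Fin n) k)) :
    AreEquivalent u v := by
  refine ⟨GeneralLinearGroup.mkOfDetNeZero P hP, fun t => ?_⟩
  have : ((GeneralLinearGroup.mkOfDetNeZero P hP : GL (Fin n) k) : Matrix (Fin n) (Fin n) k) = P :=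
    rfl
  rw [mul_assoc, this, h, ← mul_assoc]
  nth_rewrite 2 [← this]
  rw [← Units.val_mul, inv_mul_cancel, Units.val_one, one_mul]

theorem IsSL2Representation.conjGL_comp {k : Type*} [Field k] {n : ℕ}
    {ψ : SpecialLinearGroup (Fin 2) k →* SpecialLinearGroup (Fin n) k}
    (h : IsSL2Representation ψ) (P : GL (Fin n) k) :
    IsSL2Representation ((conjGL P).comp ψ) := by
  choose f hf using h
  intro i j
  refine ⟨∑ b, (∑ a, MvPolynomial.C ((P⁻¹ : GL (Fin n) k) i a) * f a b) *
    MvPolynomial.C ((P : Matrix (Fin n) (Fin n) k) b j), fun g => ?_⟩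
  simp [coe_conjGL, Matrix.mul_apply, hf]

theorem IsSL2Representation.comp_map_iterateFrobenius {k : Type*} [Field k] {n p : ℕ}
    [Fact p.Prime] [CharP k p]
    {ψ : SpecialLinearGroup (Fin 2) k →* SpecialLinearGroup (Fin n) k}
    (h : IsSL2Representation ψ) (e : ℕ) :
    IsSL2Representation (ψ.comp (SpecialLinearGroup.map (iterateFrobenius k p e))) := by
  intro i j
  obtain ⟨f, hf⟩ := h i j
  refine ⟨MvPolynomial.bind₁ (fun x => MvPolynomial.X x ^ p ^ e) f, fun g => ?_⟩
  rw [MonoidHom.comp_apply, hf, MvPolynomial.eval, MvPolynomial.eval, MvPolynomial.eval₂Hom_bind₁]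
  refine congrArg (fun y => MvPolynomial.eval₂Hom (RingHom.id k) y f) (funext fun x => ?_)
  rw [map_pow, MvPolynomial.eval₂Hom_X', ← iterateFrobenius_def]
  rfl

theorem coe_iotaPlus {k : Type*} [Field k] (t : k) :
    (iotaPlus t : Matrix (Fin 2) (Fin 2) k) = !![1, t; 0, 1] := rfl

theorem map_iterateFrobenius_iotaPlus {k : Type*} [Field k] {p : ℕ}
    [Fact p.Prime] [CharP k p] (e : ℕ) (t : k) :
    SpecialLinearGroup.map (iterateFrobenius k p e) (iotaPlus t) = iotaPlus (t ^ p ^ e) := by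
  ext i j
  fin_cases i <;> fin_cases j <;> simp [coe_iotaPlus, iterateFrobenius_def,
    (Fact.out : p.Prime).ne_zero]

theorem iotaPlus_add {k : Type*} [Field k] (s t : k) :
    iotaPlus (s + t) = iotaPlus s * iotaPlus t := by
  ext i j
  fin_cases i <;> fin_cases j <;> simp [coe_iotaPlus, add_comm]

/-- Substituting the entries of `iotaPlus t` gives polynomials in `t`, so the 𝔾ₐ-representation half
of being fundamental is automatic. -/
theorem IsSL2Representation.isFundamental {k : Type*} [Field k] {n : ℕ}
    {ψ : SpecialLinearGroup (Fin 2) k →* SpecialLinearGroup (Fin n) k}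
    (h : IsSL2Representation ψ) {u : k → SpecialLinearGroup (Fin n) k}
    (hu : ∀ t, ψ (iotaPlus t) = u t) : IsFundamental u := by
  refine ⟨⟨fun i j => ?_, fun s t => by rw [← hu, ← hu, ← hu, iotaPlus_add, map_mul]⟩, ψ, h, hu⟩
  obtain ⟨f, hf⟩ := h i j
  refine ⟨MvPolynomial.aeval (fun x => !![1, Polynomial.X; 0, 1] x.1 x.2) f, fun t => ?_⟩
  rw [← hu, hf, ← coe_evalRingHom, MvPolynomial.aeval_def, MvPolynomial.hom_eval₂,
    MvPolynomial.eval, MvPolynomial.coe_eval₂Hom]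
  congr 1
  · ext; simp
  · ext ⟨i, j⟩
    fin_cases i <;> fin_cases j <;> simp [coe_iotaPlus]

theorem IsFundamental.of_areEquivalent {k : Type*} [Field k] {n : ℕ}
    {u v : k → SpecialLinearGroup (Fin n) k} (hv : IsFundamental v) (h : AreEquivalent u v) :
    IsFundamental u := by
  obtain ⟨-, ψ, hψ, hψv⟩ := hv
  obtain ⟨P, hP⟩ := areEquivalent_iff.mp h.symm
  exact (hψ.conjGL_comp P).isFundamental fun t => by rw [MonoidHom.comp_apply, hψv, hP]

/-! ### Explicit three-dimensional representations of SL(2) -/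

/-- A multiplicative map on `2 × 2` matrices that preserves determinant one, as a homomorphism of
special linear groups. -/
def slHom {k : Type*} [Field k] {n : ℕ}
    (F : Matrix (Fin 2) (Fin 2) k → Matrix (Fin n) (Fin n) k)
    (hdet : ∀ A, A.det = 1 → (F A).det = 1) (hmul : ∀ A B, F (A * B) = F A * F B) :
    SpecialLinearGroup (Fin 2) k →* SpecialLinearGroup (Fin n) k :=
  MonoidHom.mk' (fun g => ⟨F g, hdet _ g.det_coe⟩) fun _ _ => Subtype.ext (hmul _ _)

/-- The matrix of the standard representation of `2 × 2` matrices plus a trivial summand. -/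
def stdAddTrivialMatrix {k : Type*} [Field k] (A : Matrix (Fin 2) (Fin 2) k) :
    Matrix (Fin 3) (Fin 3) k :=
  !![A 0 0, 0, A 0 1; 0, 1, 0; A 1 0, 0, A 1 1]

theorem stdAddTrivialMatrix_det {k : Type*} [Field k] (A : Matrix (Fin 2) (Fin 2) k) :
    (stdAddTrivialMatrix A).det = A.det := by
  simp [stdAddTrivialMatrix, det_fin_three, det_fin_two]

theorem stdAddTrivialMatrix_mul {k : Type*} [Field k] (A B : Matrix (Fin 2) (Fin 2) k) :
    stdAddTrivialMatrix (A * B) = stdAddTrivialMatrix A * stdAddTrivialMatrix B := by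
  ext i j
  fin_cases i <;> fin_cases j <;>
    simp [stdAddTrivialMatrix, Matrix.mul_apply, Fin.sum_univ_succ]

/-- The standard representation of `SL(2, k)` plus a trivial summand. -/
def stdAddTrivial (k : Type*) [Field k] :
    SpecialLinearGroup (Fin 2) k →* SpecialLinearGroup (Fin 3) k :=
  slHom stdAddTrivialMatrix (fun A hA => by simp [stdAddTrivialMatrix_det, hA]) stdAddTrivialMatrix_mul

theorem coe_stdAddTrivial {k : Type*} [Field k] (g : SpecialLinearGroup (Fin 2) k) :
    (stdAddTrivial k g : Matrix (Fin 3) (Fin 3) k) = stdAddTrivialMatrix g := rfl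

/-- The symmetric square of a `2 × 2` matrix. -/
def symSqMatrix {k : Type*} [Field k] (A : Matrix (Fin 2) (Fin 2) k) :
    Matrix (Fin 3) (Fin 3) k :=
  !![A 0 0 ^ 2, A 0 0 * A 0 1, A 0 1 ^ 2;
    2 * A 0 0 * A 1 0, A 0 0 * A 1 1 + A 0 1 * A 1 0, 2 * A 0 1 * A 1 1;
    A 1 0 ^ 2, A 1 0 * A 1 1, A 1 1 ^ 2]

theorem symSqMatrix_det {k : Type*} [Field k] (A : Matrix (Fin 2) (Fin 2) k) :
    (symSqMatrix A).det = A.det ^ 3 := by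
  simp [symSqMatrix, det_fin_three, det_fin_two]
  ring

theorem symSqMatrix_mul {k : Type*} [Field k] (A B : Matrix (Fin 2) (Fin 2) k) :
    symSqMatrix (A * B) = symSqMatrix A * symSqMatrix B := by
  ext i j
  fin_cases i <;> fin_cases j <;>
    simp [symSqMatrix, Matrix.mul_apply, Fin.sum_univ_succ] <;> ring

/-- The symmetric square of the standard representation of `SL(2, k)`. -/
def symSq (k : Type*) [Field k] :
    SpecialLinearGroup (Fin 2) k →* SpecialLinearGroup (Fin 3) k :=
  slHom symSqMatrix (fun A hA => by simp [symSqMatrix_det, hA]) symSqMatrix_mul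

theorem coe_symSq {k : Type*} [Field k] (g : SpecialLinearGroup (Fin 2) k) :
    (symSq k g : Matrix (Fin 3) (Fin 3) k) = symSqMatrix g := rfl

/-- The second divided power of a `2 × 2` matrix. -/
def dividedSqMatrix {k : Type*} [Field k] (A : Matrix (Fin 2) (Fin 2) k) :
    Matrix (Fin 3) (Fin 3) k :=
  !![A 0 0 ^ 2, 2 * A 0 0 * A 0 1, A 0 1 ^ 2;
    A 0 0 * A 1 0, A 0 0 * A 1 1 + A 0 1 * A 1 0, A 0 1 * A 1 1;
    A 1 0 ^ 2, 2 * A 1 0 * A 1 1, A 1 1 ^ 2]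

theorem dividedSqMatrix_det {k : Type*} [Field k] (A : Matrix (Fin 2) (Fin 2) k) :
    (dividedSqMatrix A).det = A.det ^ 3 := by
  simp [dividedSqMatrix, det_fin_three, det_fin_two]
  ring

theorem dividedSqMatrix_mul {k : Type*} [Field k] (A B : Matrix (Fin 2) (Fin 2) k) :
    dividedSqMatrix (A * B) = dividedSqMatrix A * dividedSqMatrix B := by
  ext i j
  fin_cases i <;> fin_cases j <;>
    simp [dividedSqMatrix, Matrix.mul_apply, Fin.sum_univ_succ] <;> ring

/-- The second divided power of the standard representation of `SL(2, k)`. -/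
def dividedSq (k : Type*) [Field k] :
    SpecialLinearGroup (Fin 2) k →* SpecialLinearGroup (Fin 3) k :=
  slHom dividedSqMatrix (fun A hA => by simp [dividedSqMatrix_det, hA]) dividedSqMatrix_mul

theorem coe_dividedSq {k : Type*} [Field k] (g : SpecialLinearGroup (Fin 2) k) :
    (dividedSq k g : Matrix (Fin 3) (Fin 3) k) = dividedSqMatrix g := rfl

theorem isSL2Representation_of_matrix {k : Type*} [Field k] {n : ℕ}
    {ψ : SpecialLinearGroup (Fin 2) k →* SpecialLinearGroup (Fin n) k}
    (F : Matrix (Fin n) (Fin n) (MvPolynomial (Fin 2 × Fin 2) k))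
    (hF : ∀ g : SpecialLinearGroup (Fin 2) k, (ψ g : Matrix (Fin n) (Fin n) k) =
      F.map (MvPolynomial.eval fun x => (g : Matrix (Fin 2) (Fin 2) k) x.1 x.2)) :
    IsSL2Representation ψ :=
  fun i j => ⟨F i j, fun g => by rw [hF]; rfl⟩

open MvPolynomial in
theorem isSL2Representation_stdAddTrivial (k : Type*) [Field k] :
    IsSL2Representation (stdAddTrivial k) :=
  isSL2Representation_of_matrix !![X (0, 0), 0, X (0, 1); 0, 1, 0; X (1, 0), 0, X (1, 1)]
    fun g => by
      ext i j
      fin_cases i <;> fin_cases j <;> simp [coe_stdAddTrivial, stdAddTrivialMatrix]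

open MvPolynomial in
theorem isSL2Representation_symSq (k : Type*) [Field k] : IsSL2Representation (symSq k) :=
  isSL2Representation_of_matrix !![X (0, 0) ^ 2, X (0, 0) * X (0, 1), X (0, 1) ^ 2;
      C 2 * X (0, 0) * X (1, 0), X (0, 0) * X (1, 1) + X (0, 1) * X (1, 0),
      C 2 * X (0, 1) * X (1, 1);
      X (1, 0) ^ 2, X (1, 0) * X (1, 1), X (1, 1) ^ 2]
    fun g => by
      ext i j
      fin_cases i <;> fin_cases j <;> simp [coe_symSq, symSqMatrix]

open MvPolynomial in
theorem isSL2Representation_dividedSq (k : Type*) [Field k] :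
    IsSL2Representation (dividedSq k) :=
  isSL2Representation_of_matrix !![X (0, 0) ^ 2, C 2 * X (0, 0) * X (0, 1), X (0, 1) ^ 2;
      X (0, 0) * X (1, 0), X (0, 0) * X (1, 1) + X (0, 1) * X (1, 0), X (0, 1) * X (1, 1);
      X (1, 0) ^ 2, C 2 * X (1, 0) * X (1, 1), X (1, 1) ^ 2]
    fun g => by
      ext i j
      fin_cases i <;> fin_cases j <;> simp [coe_dividedSq, dividedSqMatrix]

theorem isFundamental_of_eq_one {k : Type*} [Field k] {n : ℕ}
    {v : k → SpecialLinearGroup (Fin n) k} (h : ∀ t, v t = 1) : IsFundamental v := by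
  refine IsSL2Representation.isFundamental (ψ := 1) (fun i j => ?_) fun t => (h t).symm
  exact ⟨MvPolynomial.C ((1 : Matrix (Fin n) (Fin n) k) i j), fun g => by simp⟩

theorem isFundamental_of_stdAddTrivial {k : Type*} [Field k] {p : ℕ} [Fact p.Prime] [CharP k p]
    {v : k → SpecialLinearGroup (Fin 3) k} {e : ℕ}
    (h : ∀ t, (v t : Matrix (Fin 3) (Fin 3) k) = !![1, 0, t ^ p ^ e; 0, 1, 0; 0, 0, 1]) :
    IsFundamental v := by
  refine ((isSL2Representation_stdAddTrivial k).comp_map_iterateFrobenius (p := p) e).isFundamental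
    fun t => ?_
  rw [MonoidHom.comp_apply, map_iterateFrobenius_iotaPlus]
  refine Subtype.ext ?_
  rw [h]
  ext i j
  fin_cases i <;> fin_cases j <;> simp [coe_stdAddTrivial, stdAddTrivialMatrix, coe_iotaPlus]

theorem isFundamental_of_symSq {k : Type*} [Field k] {p : ℕ} [Fact p.Prime] [CharP k p]
    {v : k → SpecialLinearGroup (Fin 3) k} {e : ℕ}
    (h : ∀ t, (v t : Matrix (Fin 3) (Fin 3) k) =
      !![1, t ^ p ^ e, t ^ (2 * p ^ e); 0, 1, 2 * t ^ p ^ e; 0, 0, 1]) :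
    IsFundamental v := by
  refine ((isSL2Representation_symSq k).comp_map_iterateFrobenius (p := p) e).isFundamental
    fun t => ?_
  rw [MonoidHom.comp_apply, map_iterateFrobenius_iotaPlus]
  refine Subtype.ext ?_
  rw [h]
  ext i j
  fin_cases i <;> fin_cases j <;> simp [coe_symSq, symSqMatrix, coe_iotaPlus, ← pow_mul, mul_comm]

theorem isFundamental_of_dividedSq {k : Type*} [Field k] {p : ℕ} [Fact p.Prime] [CharP k p]
    {v : k → SpecialLinearGroup (Fin 3) k} {e : ℕ}
    (h : ∀ t, (v t : Matrix (Fin 3) (Fin 3) k) =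
      !![1, 2 * t ^ p ^ e, t ^ (2 * p ^ e); 0, 1, t ^ p ^ e; 0, 0, 1]) :
    IsFundamental v := by
  refine ((isSL2Representation_dividedSq k).comp_map_iterateFrobenius (p := p) e).isFundamental
    fun t => ?_
  rw [MonoidHom.comp_apply, map_iterateFrobenius_iotaPlus]
  refine Subtype.ext ?_
  rw [h]
  ext i j
  fin_cases i <;> fin_cases j <;> simp [coe_dividedSq, dividedSqMatrix, coe_iotaPlus, ← pow_mul, mul_comm]

/-! ### Unitriangular matrices -/

/-- The upper unitriangular matrix with the given entries above the diagonal. -/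
def unitriangular {k : Type*} [Field k] (a b c : k) : SpecialLinearGroup (Fin 3) k :=
  ⟨!![1, a, c; 0, 1, b; 0, 0, 1], by simp [det_fin_three]⟩

theorem coe_unitriangular {k : Type*} [Field k] (a b c : k) :
    (unitriangular a b c : Matrix (Fin 3) (Fin 3) k) = !![1, a, c; 0, 1, b; 0, 0, 1] := rfl

theorem unitriangular_mul {k : Type*} [Field k] (a b c a' b' c' : k) :
    unitriangular a b c * unitriangular a' b' c' =
      unitriangular (a + a') (b + b') (c + c' + a * b') := by
  ext i j
  fin_cases i <;> fin_cases j <;>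
    simp [coe_unitriangular, Matrix.mul_apply, Fin.sum_univ_succ] <;> ring

theorem unitriangular_inj {k : Type*} [Field k] {a b c a' b' c' : k} :
    unitriangular a b c = unitriangular a' b' c' ↔ a = a' ∧ b = b' ∧ c = c' := by
  refine ⟨fun h => ?_, by rintro ⟨rfl, rfl, rfl⟩; rfl⟩
  have h' := fun i j => congrFun (congrFun (congrArg Subtype.val h) i) j
  exact ⟨h' 0 1, h' 1 2, h' 0 2⟩

/-- Conjugation by `diag(xy, y, 1)`. When one of `f`, `g` vanishes, its factor is free and can be
used to normalize the corner. -/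
theorem areEquivalent_unitriangular_scale {k : Type*} [Field k] (f g h : k → k) {x y : k}
    (hx : x ≠ 0) (hy : y ≠ 0) :
    AreEquivalent (fun t => unitriangular (x * f t) (y * g t) (x * y * h t))
      fun t => unitriangular (f t) (g t) (h t) := by
  refine areEquivalent_of_mul_eq !![x * y, 0, 0; 0, y, 0; 0, 0, 1]
    (by simp [det_fin_three, hx, hy]) fun t => ?_
  ext i j
  fin_cases i <;> fin_cases j <;>
    simp [coe_unitriangular, Matrix.mul_apply, Fin.sum_univ_succ]
  ring

/-! ### The torus, the Weyl element and the weights -/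

/-- The diagonal maximal torus of `SL(2, k)`. -/
def diagTorus (k : Type*) [Field k] : kˣ →* SpecialLinearGroup (Fin 2) k :=
  MonoidHom.mk' (fun z => ⟨!![(z : k), 0; 0, (z : k)⁻¹], by simp [det_fin_two]⟩) fun z w =>
    Subtype.ext <| by
      change !![((z * w : kˣ) : k), 0; 0, ((z * w : kˣ) : k)⁻¹] =
        !![(z : k), 0; 0, (z : k)⁻¹] * !![(w : k), 0; 0, (w : k)⁻¹]
      simp [mul_comm]

theorem coe_diagTorus {k : Type*} [Field k] (z : kˣ) :
    (diagTorus k z : Matrix (Fin 2) (Fin 2) k) = !![(z : k), 0; 0, (z : k)⁻¹] := rfl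

/-- The nontrivial Weyl group element of `SL(2, k)`. -/
def weylElement (k : Type*) [Field k] : SpecialLinearGroup (Fin 2) k :=
  ⟨!![0, 1; -1, 0], by simp [det_fin_two]⟩

theorem coe_weylElement {k : Type*} [Field k] :
    (weylElement k : Matrix (Fin 2) (Fin 2) k) = !![0, 1; -1, 0] := rfl

theorem diagTorus_mul_weylElement {k : Type*} [Field k] (z : kˣ) :
    diagTorus k z * weylElement k = weylElement k * diagTorus k z⁻¹ := by
  ext i j
  fin_cases i <;> fin_cases j <;> simp [coe_diagTorus, coe_weylElement]

theorem diagTorus_mul_iotaPlus {k : Type*} [Field k] (z : kˣ) (t : k) :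
    diagTorus k z * iotaPlus t = iotaPlus ((z : k) ^ 2 * t) * diagTorus k z := by
  ext i j
  fin_cases i <;> fin_cases j <;> simp [coe_diagTorus, coe_iotaPlus]
  field_simp

theorem IsSL2Representation.exists_conj_torus_diagonal {k : Type*} [Field k] [Infinite k] {n : ℕ}
    {ψ : SpecialLinearGroup (Fin 2) k →* SpecialLinearGroup (Fin n) k}
    (h : IsSL2Representation ψ) : ∃ (P : GL (Fin n) k) (a : Fin n → ℤ), ∀ z : kˣ,
      (conjGL P (ψ (diagTorus k z)) : Matrix (Fin n) (Fin n) k) =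
        diagonal fun i => (z : k) ^ a i := by
  choose f hf using h
  choose N g hg using fun i j => exists_pow_mul_eval_torus (f i j)
  -- A single power of `z` must clear the denominators of all entries.
  let M := ∑ i, ∑ j, N i j
  have hM : ∀ i j, N i j ≤ M := fun i j =>
    (Finset.single_le_sum (f := fun j => N i j) (fun _ _ => Nat.zero_le _)
      (Finset.mem_univ j)).trans (Finset.single_le_sum (f := fun i => ∑ j, N i j)
      (fun _ _ => Nat.zero_le _) (Finset.mem_univ i))
  obtain ⟨P, a, hP⟩ := exists_diagonalization
    ((Units.coeHom _).comp (SpecialLinearGroup.toGL.comp (ψ.comp (diagTorus k)))) M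
    (fun i j => Polynomial.X ^ (M - N i j) * g i j) (fun z i j => by
      have := hg i j z z.ne_zero
      rw [Polynomial.eval_mul, ← this, Polynomial.eval_pow, Polynomial.eval_X, ← mul_assoc,
        ← pow_add, Nat.sub_add_cancel (hM i j)]
      congr 1
      exact hf i j _)
  refine ⟨P, a, fun z => ?_⟩
  rw [coe_conjGL, mul_assoc]
  refine (congrArg _ (hP z)).trans ?_
  rw [← mul_assoc, ← Units.val_mul, inv_mul_cancel, Units.val_one, one_mul]

theorem weights_sum_eq_zero {k : Type*} [Field k] [Infinite k] {n : ℕ}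
    {φ : SpecialLinearGroup (Fin 2) k →* SpecialLinearGroup (Fin n) k} {a : Fin n → ℤ}
    (h : ∀ z : kˣ, (φ (diagTorus k z) : Matrix (Fin n) (Fin n) k) =
      diagonal fun i => (z : k) ^ a i) : ∑ i, a i = 0 := by
  refine eq_zero_of_forall_zpow_eq_one (k := k) fun z hz => ?_
  have := (φ (diagTorus k (Units.mk0 z hz))).det_coe
  rw [h, det_diagonal] at this
  rw [← this]
  generalize (Finset.univ : Finset (Fin n)) = s
  induction s using Finset.induction_on with
  | empty => simp
  | insert i s hi ih => rw [Finset.sum_insert hi, Finset.prod_insert hi, zpow_add₀ hz, ih]; rfl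

/-- The Weyl element inverts the torus, so it sends weight `a j` to `-a j`; a nonzero entry in
column `j` of its image locates a vector of the opposite weight. -/
theorem weights_symmetric {k : Type*} [Field k] [Infinite k] {n : ℕ}
    {φ : SpecialLinearGroup (Fin 2) k →* SpecialLinearGroup (Fin n) k} {a : Fin n → ℤ}
    (h : ∀ z : kˣ, (φ (diagTorus k z) : Matrix (Fin n) (Fin n) k) =
      diagonal fun i => (z : k) ^ a i) (j : Fin n) : ∃ i, a i = -a j := by
  let W : Matrix (Fin n) (Fin n) k := φ (weylElement k)
  obtain ⟨i, hi⟩ : ∃ i, W i j ≠ 0 := by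
    by_contra! hW
    have : W.det = 0 := det_eq_zero_of_column_eq_zero j hW
    exact one_ne_zero ((φ (weylElement k)).det_coe.symm.trans this)
  refine ⟨i, eq_neg_of_add_eq_zero_left (eq_zero_of_forall_zpow_eq_one (k := k) fun z hz => ?_)⟩
  have h1 := congrArg φ (diagTorus_mul_weylElement (Units.mk0 z hz))
  rw [map_mul, map_mul] at h1
  have h2 := congrFun (congrFun (congrArg Subtype.val h1) i) j
  change ((φ (diagTorus k _) : Matrix (Fin n) (Fin n) k) * W) i j =
    (W * (φ (diagTorus k _) : Matrix (Fin n) (Fin n) k)) i j at h2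
  rw [h, h, diagonal_mul, mul_diagonal, mul_comm (W i j)] at h2
  have h3 := mul_right_cancel₀ hi h2
  simp only [Units.val_mk0, Units.val_inv_eq_inv_val, _root_.inv_zpow] at h3
  rw [zpow_add₀ hz, h3, inv_mul_cancel₀ (zpow_ne_zero _ hz)]

theorem exists_perm_eq_of_symmetric {a : Fin 3 → ℤ} (hs : ∑ i, a i = 0)
    (ha : ∀ j, ∃ i, a i = -a j) :
    ∃ (σ : Equiv.Perm (Fin 3)) (m : ℕ), ∀ i, a (σ i) = ![(m : ℤ), 0, -m] i := by
  obtain ⟨σ, h0, h1⟩ : ∃ σ : Equiv.Perm (Fin 3), a (σ 1) = 0 ∧ 0 ≤ a (σ 0) := by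
    -- If the weight opposite to `a 0` is `a 0` itself, then `a 0 = 0`; otherwise the sum forces the
    -- third weight to vanish.
    have key : ∃ i, a i = 0 := by
      obtain ⟨i, hi⟩ := ha 0
      rw [Fin.sum_univ_three] at hs
      fin_cases i <;> simp at hi
      · exact ⟨0, by omega⟩
      · exact ⟨2, by omega⟩
      · exact ⟨1, by omega⟩
    obtain ⟨i, hi⟩ := key
    have hτ : a (Equiv.swap 1 i 1) = 0 := by simpa using hi
    by_cases h : 0 ≤ a (Equiv.swap 1 i 0)
    · exact ⟨_, hτ, h⟩
    · refine ⟨Equiv.swap 1 i * Equiv.swap 0 2, ?_, ?_⟩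
      · simpa [Equiv.swap_apply_of_ne_of_ne] using hi
      · have := Equiv.sum_comp (Equiv.swap 1 i) a
        rw [hs, Fin.sum_univ_three] at this
        simp only [Equiv.Perm.mul_apply, Equiv.swap_apply_left]
        omega
  refine ⟨σ, (a (σ 0)).toNat, fun i => ?_⟩
  have := Equiv.sum_comp σ a
  rw [hs, Fin.sum_univ_three] at this
  fin_cases i
  · simp [h1]
  · simpa using h0
  · simp [h1]
    omega

theorem conjGL_submatrix_diagonal {k : Type*} [Field k] {n : ℕ}
    (σ : Equiv.Perm (Fin n)) : ∃ Q : GL (Fin n) k, ∀ (g : SpecialLinearGroup (Fin n) k) d,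
      (g : Matrix (Fin n) (Fin n) k) = diagonal d →
      (conjGL Q g : Matrix (Fin n) (Fin n) k) = diagonal (d ∘ σ) := by
  have hdet : ((1 : Matrix (Fin n) (Fin n) k).submatrix id σ).det ≠ 0 := by
    rw [det_permute']
    rcases Int.units_eq_one_or (Equiv.Perm.sign σ) with h | h <;> simp [h]
  let Q := GeneralLinearGroup.mkOfDetNeZero _ hdet
  refine ⟨Q, fun g d hg => ?_⟩
  have hQ : (g : Matrix (Fin n) (Fin n) k) * (Q : Matrix (Fin n) (Fin n) k) =
      (Q : Matrix (Fin n) (Fin n) k) * diagonal (d ∘ σ) := by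
    rw [hg]
    ext i j
    change (diagonal d * (1 : Matrix (Fin n) (Fin n) k).submatrix id σ) i j =
      ((1 : Matrix (Fin n) (Fin n) k).submatrix id σ * diagonal (d ∘ σ)) i j
    rw [diagonal_mul, mul_diagonal]
    by_cases h : i = σ j <;> simp [h, mul_comm]
  rw [coe_conjGL, mul_assoc, hQ, ← mul_assoc, ← Units.val_mul, inv_mul_cancel, Units.val_one,
    one_mul]

theorem IsSL2Representation.exists_conj_torus_standard {k : Type*} [Field k] [Infinite k]
    {ψ : SpecialLinearGroup (Fin 2) k →* SpecialLinearGroup (Fin 3) k}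
    (h : IsSL2Representation ψ) : ∃ (P : GL (Fin 3) k) (m : ℕ), ∀ z : kˣ,
      (conjGL P (ψ (diagTorus k z)) : Matrix (Fin 3) (Fin 3) k) =
        diagonal fun i => (z : k) ^ (![(m : ℤ), 0, -m] i) := by
  obtain ⟨P, a, hP⟩ := h.exists_conj_torus_diagonal
  obtain ⟨σ, m, hσ⟩ := exists_perm_eq_of_symmetric
    (weights_sum_eq_zero (φ := (conjGL P).comp ψ) hP)
    (weights_symmetric (φ := (conjGL P).comp ψ) hP)
  obtain ⟨Q, hQ⟩ := conjGL_submatrix_diagonal (k := k) σ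
  refine ⟨P * Q, m, fun z => ?_⟩
  rw [conjGL_mul, hQ _ _ (hP z)]
  simp only [Function.comp_def, hσ]

/-! ### Monomial entries from torus equivariance -/

/-- The relation between `diagTorus` and `iotaPlus` at `t = 1` reads `f(z²) = z ^ (a i - a j) *
f(1)` for the polynomial `f` of the entry. -/
theorem entry_eq_monomial_of_torus_diagonal {k : Type*} [Field k] [IsAlgClosed k] {n : ℕ}
    {φ : SpecialLinearGroup (Fin 2) k →* SpecialLinearGroup (Fin n) k} {a : Fin n → ℤ}
    (hφ : IsGaMorphism fun t : k => φ (iotaPlus t))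
    (h : ∀ z : kˣ, (φ (diagTorus k z) : Matrix (Fin n) (Fin n) k) =
      diagonal fun i => (z : k) ^ a i) (i j : Fin n) :
    (∀ t, (φ (iotaPlus t) : Matrix (Fin n) (Fin n) k) i j = 0) ∨
      ∃ (r : ℕ) (c : k), a i - a j = 2 * r ∧
        ∀ t, (φ (iotaPlus t) : Matrix (Fin n) (Fin n) k) i j = c * t ^ r := by
  obtain ⟨f, hf⟩ := hφ i j
  have key : f = 0 ∨ ∃ (r : ℕ) (c : k), a i - a j = 2 * r ∧
      f = Polynomial.C c * Polynomial.X ^ r := by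
    refine Polynomial.eq_monomial_of_sq_homogeneous fun z hz => ?_
    have h1 := congrArg φ (diagTorus_mul_iotaPlus (Units.mk0 z hz) 1)
    rw [map_mul, map_mul] at h1
    have h2 := congrFun (congrFun (congrArg Subtype.val h1) i) j
    change ((φ (diagTorus k _) : Matrix (Fin n) (Fin n) k) *
        (φ (iotaPlus 1) : Matrix (Fin n) (Fin n) k)) i j =
      ((φ (iotaPlus _) : Matrix (Fin n) (Fin n) k) *
        (φ (diagTorus k _) : Matrix (Fin n) (Fin n) k)) i j at h2
    rw [h, diagonal_mul, mul_diagonal, Units.val_mk0, mul_one, hf, hf] at h2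
    rw [zpow_sub₀ hz, div_mul_eq_mul_div, h2, mul_div_cancel_right₀ _ (zpow_ne_zero _ hz)]
  rcases key with rfl | ⟨r, c, hr, rfl⟩
  · exact Or.inl fun t => by simp [hf]
  · exact Or.inr ⟨r, c, hr, fun t => by simp [hf]⟩

/-- Up to equivalence, a fundamental representation in dimension three is unitriangular with
monomial entries whose degrees are halves of weight differences. -/
theorem IsFundamental.exists_areEquivalent_unitriangular {k : Type*} [Field k] [IsAlgClosed k]
    {u : k → SpecialLinearGroup (Fin 3) k} (hu : IsFundamental u) :
    ∃ (r m : ℕ) (α β γ : k), (m = 2 * r ∨ α = 0 ∧ β = 0) ∧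
      AreEquivalent u fun t => unitriangular (α * t ^ r) (β * t ^ r) (γ * t ^ m) := by
  have : Infinite k := IsAlgClosed.instInfinite
  obtain ⟨-, ψ, hψ, hψu⟩ := hu
  obtain ⟨P, m, hP⟩ := hψ.exists_conj_torus_standard
  have hv : ∀ t, conjGL P (u t) = ((conjGL P).comp ψ) (iotaPlus t) := fun t => by
    rw [MonoidHom.comp_apply, hψu]
  have hent := entry_eq_monomial_of_torus_diagonal (φ := (conjGL P).comp ψ)
    ((hψ.conjGL_comp P).isFundamental fun _ => rfl).1.1 hP
  have h0 : ∀ i j, (((conjGL P).comp ψ) (iotaPlus 0) : Matrix (Fin 3) (Fin 3) k) i j =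
      (1 : Matrix (Fin 3) (Fin 3) k) i j := by
    have : (iotaPlus 0 : SpecialLinearGroup (Fin 2) k) = 1 := by
      ext i j
      fin_cases i <;> fin_cases j <;> simp [coe_iotaPlus]
    intro i j
    rw [this, map_one]
    simp
  -- A weight difference that is not positive leaves only degree zero, so the entry keeps its value
  -- at `t = 0`.
  have hconst : ∀ i j, ![(m : ℤ), 0, -m] i ≤ ![(m : ℤ), 0, -m] j → ∀ t,
      (((conjGL P).comp ψ) (iotaPlus t) : Matrix (Fin 3) (Fin 3) k) i j =
        (1 : Matrix (Fin 3) (Fin 3) k) i j := by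
    intro i j hij t
    rw [← h0]
    rcases hent i j with h | ⟨r, c, hr, h⟩
    · rw [h, h]
    · have : r = 0 := by omega
      rw [h, h, this, pow_zero, pow_zero]
  generalize (conjGL P).comp ψ = φ at *
  suffices H : ∃ (r : ℕ) (α β γ : k), (m = 2 * r ∨ α = 0 ∧ β = 0) ∧ ∀ t,
      (φ (iotaPlus t) : Matrix (Fin 3) (Fin 3) k) 0 1 = α * t ^ r ∧
      (φ (iotaPlus t) : Matrix (Fin 3) (Fin 3) k) 1 2 = β * t ^ r ∧
      (φ (iotaPlus t) : Matrix (Fin 3) (Fin 3) k) 0 2 = γ * t ^ m by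
    obtain ⟨r, α, β, γ, hr, H⟩ := H
    refine ⟨r, m, α, β, γ, hr, areEquivalent_iff.mpr ⟨P, fun t => ?_⟩⟩
    obtain ⟨h01, h12, h02⟩ := H t
    rw [hv]
    refine Subtype.ext ?_
    rw [coe_unitriangular]
    ext i j
    fin_cases i <;> fin_cases j
    · exact hconst 0 0 (by simp) t
    · exact h01
    · exact h02
    · exact hconst 1 0 (by simp) t
    · exact hconst 1 1 (by simp) t
    · exact h12
    · exact hconst 2 0 (by simp) t
    · exact hconst 2 1 (by simp) t
    · exact hconst 2 2 (by simp) t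
  have h02 : ∃ γ, ∀ t, (φ (iotaPlus t) : Matrix (Fin 3) (Fin 3) k) 0 2 = γ * t ^ m := by
    rcases hent 0 2 with h | ⟨r, c, hr, h⟩
    · exact ⟨0, fun t => by rw [h, zero_mul]⟩
    · simp at hr
      obtain rfl : r = m := by omega
      exact ⟨c, h⟩
  obtain ⟨γ, h02⟩ := h02
  rcases Nat.even_or_odd' m with ⟨r, hm | hm⟩
  · have key : ∀ i j, ![(m : ℤ), 0, -m] i - ![(m : ℤ), 0, -m] j = m →
        ∃ c, ∀ t, (φ (iotaPlus t) : Matrix (Fin 3) (Fin 3) k) i j = c * t ^ r := by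
      intro i j hij
      rcases hent i j with h | ⟨s, c, hs, h⟩
      · exact ⟨0, fun t => by rw [h, zero_mul]⟩
      · obtain rfl : s = r := by omega
        exact ⟨c, h⟩
    obtain ⟨α, h01⟩ := key 0 1 (by simp)
    obtain ⟨β, h12⟩ := key 1 2 (by simp)
    exact ⟨r, α, β, γ, Or.inl hm, fun t => ⟨h01 t, h12 t, h02 t⟩⟩
  -- For odd `m` the difference between adjacent weights is not twice an integer, so both
  -- near-diagonal entries vanish and `r` is arbitrary.
  · have key : ∀ i j, ![(m : ℤ), 0, -m] i - ![(m : ℤ), 0, -m] j = m →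
        ∀ t, (φ (iotaPlus t) : Matrix (Fin 3) (Fin 3) k) i j = 0 := by
      intro i j hij
      rcases hent i j with h | ⟨s, c, hs, h⟩
      · exact h
      · omega
    refine ⟨0, 0, 0, γ, Or.inr ⟨rfl, rfl⟩, fun t => ⟨?_, ?_, h02 t⟩⟩
    · rw [key 0 1 (by simp), zero_mul]
    · rw [key 1 2 (by simp), zero_mul]

/-! ### Normal forms -/

theorem areEquivalent_unitriangular_fst {k : Type*} [Field k] (f : k → k) :
    AreEquivalent (fun t => unitriangular (f t) 0 0) fun t => unitriangular 0 0 (f t) := by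
  refine areEquivalent_of_mul_eq !![1, 0, 0; 0, 0, 1; 0, 1, 0] (by simp [det_fin_three])
    fun t => ?_
  ext i j
  fin_cases i <;> fin_cases j <;>
    simp [coe_unitriangular, Matrix.mul_apply, Fin.sum_univ_succ]

theorem areEquivalent_unitriangular_snd {k : Type*} [Field k] (f : k → k) :
    AreEquivalent (fun t => unitriangular 0 (f t) 0) fun t => unitriangular 0 0 (f t) := by
  refine areEquivalent_of_mul_eq !![0, 1, 0; 1, 0, 0; 0, 0, 1] (by simp [det_fin_three])
    fun t => ?_
  ext i j
  fin_cases i <;> fin_cases j <;>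
    simp [coe_unitriangular, Matrix.mul_apply, Fin.sum_univ_succ]

theorem IsGaRepresentation.of_areEquivalent_map_add {k : Type*} [Field k] {n : ℕ}
    {u v : k → SpecialLinearGroup (Fin n) k} (hu : IsGaRepresentation u) (h : AreEquivalent u v)
    (s t : k) : v (s + t) = v s * v t := by
  obtain ⟨P, hP⟩ := areEquivalent_iff.mp h
  rw [← hP, ← hP, ← hP, hu.2, map_mul]

/-- The list of unitriangular normal forms of fundamental representations in dimension three,
uniform in the characteristic. -/
theorem IsFundamental.normal_forms {k : Type*} [Field k] [IsAlgClosed k] {p : ℕ} (hp : p.Prime)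
    [CharP k p] {u : k → SpecialLinearGroup (Fin 3) k} (hu : IsFundamental u) :
    (AreEquivalent u fun _ => unitriangular 0 0 0) ∨
    ∃ e : ℕ, (AreEquivalent u fun t => unitriangular 0 0 (t ^ p ^ e)) ∨
      ((2 : k) = 0 ∧
        ((AreEquivalent u fun t => unitriangular (t ^ p ^ e) 0 (t ^ (2 * p ^ e))) ∨
          AreEquivalent u fun t => unitriangular 0 (t ^ p ^ e) (t ^ (2 * p ^ e)))) ∨
      ((2 : k) ≠ 0 ∧ AreEquivalent u fun t =>
        unitriangular (t ^ p ^ e) (t ^ p ^ e) (1 / 2 * t ^ (2 * p ^ e))) := by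
  have : Infinite k := IsAlgClosed.instInfinite
  obtain ⟨r, m, α, β, γ, hm, heq⟩ := hu.exists_areEquivalent_unitriangular
  have hadd : ∀ s t : k, α * (s + t) ^ r = α * s ^ r + α * t ^ r ∧
      β * (s + t) ^ r = β * s ^ r + β * t ^ r ∧
      γ * (s + t) ^ m = γ * s ^ m + γ * t ^ m + α * s ^ r * (β * t ^ r) := fun s t => by
    have := hu.1.of_areEquivalent_map_add heq s t
    rwa [unitriangular_mul, unitriangular_inj] at this
  by_cases hαβ : α = 0 ∧ β = 0
  · obtain ⟨rfl, rfl⟩ := hαβ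
    by_cases hγ : γ = 0
    · left
      simpa [hγ] using heq
    · right
      obtain ⟨e, rfl⟩ := eq_prime_pow_of_pow_add (k := k) hp (n := m) fun s t => by
        have := (hadd s t).2.2
        apply mul_left_cancel₀ hγ
        linear_combination this
      refine ⟨e, Or.inl (heq.trans ?_)⟩
      simpa using areEquivalent_unitriangular_scale (fun _ => 0) (fun _ => 0)
        (fun t => t ^ p ^ e) hγ one_ne_zero
  right
  obtain rfl : m = 2 * r := hm.resolve_right hαβ
  have hr : ∀ s t : k, (s + t) ^ r = s ^ r + t ^ r := fun s t => by
    rcases not_and_or.mp hαβ with h | h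
    · apply mul_left_cancel₀ h
      linear_combination (hadd s t).1
    · apply mul_left_cancel₀ h
      linear_combination (hadd s t).2.1
  -- At `s = t = 1`, `(1 + 1) ^ r = 2` and the corner identity becomes `4γ = 2γ + αβ`.
  have hγ : 2 * γ = α * β := by
    have h1 := hr 1 1
    have h2 := (hadd 1 1).2.2
    rw [mul_comm 2 r, pow_mul, h1] at h2
    simp only [one_pow] at h2
    linear_combination h2
  obtain ⟨e, rfl⟩ := eq_prime_pow_of_pow_add hp hr
  refine ⟨e, ?_⟩
  by_cases hβ : β = 0
  · have hα : α ≠ 0 := fun h => hαβ ⟨h, hβ⟩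
    subst hβ
    by_cases hγ0 : γ = 0
    · left
      subst hγ0
      refine heq.trans (.trans ?_ (areEquivalent_unitriangular_fst fun t => t ^ p ^ e))
      simpa using areEquivalent_unitriangular_scale (fun t => t ^ p ^ e) (fun _ => 0)
        (fun _ => 0) hα one_ne_zero
    -- Here `2γ = 0` with `γ ≠ 0` forces characteristic 2. As `β = 0`, the second scale is free; `γ
    -- / α` normalizes the corner.
    · refine Or.inr (Or.inl ⟨by simpa [hγ0] using hγ, Or.inl (heq.trans ?_)⟩)
      simpa [mul_div_cancel₀ _ hα] using areEquivalent_unitriangular_scale (fun t => t ^ p ^ e)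
        (fun _ => 0) (fun t => t ^ (2 * p ^ e)) hα (div_ne_zero hγ0 hα)
  by_cases hα : α = 0
  · subst hα
    by_cases hγ0 : γ = 0
    · left
      subst hγ0
      refine heq.trans (.trans ?_ (areEquivalent_unitriangular_snd fun t => t ^ p ^ e))
      simpa using areEquivalent_unitriangular_scale (fun _ => 0) (fun t => t ^ p ^ e)
        (fun _ => 0) one_ne_zero hβ
    · refine Or.inr (Or.inl ⟨by simpa [hγ0] using hγ, Or.inr (heq.trans ?_)⟩)
      simpa [div_mul_cancel₀ _ hβ] using areEquivalent_unitriangular_scale (fun _ => 0)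
        (fun t => t ^ p ^ e) (fun t => t ^ (2 * p ^ e)) (div_ne_zero hγ0 hβ) hβ
  · have h2 : (2 : k) ≠ 0 := fun h => by
      rw [h, zero_mul] at hγ
      exact mul_ne_zero hα hβ hγ.symm
    refine Or.inr (Or.inr ⟨h2, heq.trans ?_⟩)
    have hγ' : γ = α * β * (1 / 2) := by
      field_simp
      linear_combination hγ
    have := areEquivalent_unitriangular_scale (fun t => t ^ p ^ e) (fun t => t ^ p ^ e)
      (fun t => 1 / 2 * t ^ (2 * p ^ e)) hα hβ
    simpa only [hγ', mul_assoc] using this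

/-! ### The listed forms are fundamental; conclusion -/

theorem HasFormCharTwo.isFundamental {k : Type*} [Field k] {p : ℕ} (hp : p.Prime) [CharP k p]
    (h2 : (2 : k) = 0) {v : k → SpecialLinearGroup (Fin 3) k} (h : HasFormCharTwo p v) :
    IsFundamental v := by
  have : Fact p.Prime := ⟨hp⟩
  rcases h with ⟨e, h⟩ | ⟨e, h⟩ | ⟨e, h⟩ | h
  · exact isFundamental_of_stdAddTrivial h
  · exact isFundamental_of_symSq (p := p) (e := e) fun t => by rw [h, h2, zero_mul]
  · exact isFundamental_of_dividedSq (p := p) (e := e) fun t => by rw [h, h2, zero_mul]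
  · exact isFundamental_of_eq_one fun t => Subtype.ext ((h t).trans one_fin_three.symm)

theorem HasFormCharOdd.isFundamental {k : Type*} [Field k] {p : ℕ} (hp : p.Prime) [CharP k p]
    (h2 : (2 : k) ≠ 0) {v : k → SpecialLinearGroup (Fin 3) k} (h : HasFormCharOdd p v) :
    IsFundamental v := by
  have : Fact p.Prime := ⟨hp⟩
  rcases h with ⟨e, h⟩ | ⟨e, h⟩ | h
  -- The symmetric square restricts to entries `T`, `2T`, `T²` with `T = t ^ p ^ e`; scaling by `x =
  -- 1`, `y = 2` yields the listed form.
  · have hw : IsFundamental fun t : k =>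
        unitriangular (1 * t ^ p ^ e) (2 * t ^ p ^ e) (1 * 2 * (1 / 2 * t ^ (2 * p ^ e))) :=
      isFundamental_of_symSq (p := p) (e := e) fun t => by
        rw [coe_unitriangular]
        field_simp
    refine hw.of_areEquivalent (AreEquivalent.symm ?_)
    have hv : v = fun t => unitriangular (t ^ p ^ e) (t ^ p ^ e) (1 / 2 * t ^ (2 * p ^ e)) :=
      funext fun t => Subtype.ext (h t)
    rw [hv]
    exact areEquivalent_unitriangular_scale _ _ _ one_ne_zero h2
  · exact isFundamental_of_stdAddTrivial h
  · exact isFundamental_of_eq_one fun t => Subtype.ext ((h t).trans one_fin_three.symm)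

end

theorem theorem4p1 {k : Type*} [Field k] [IsAlgClosed k] (p : ℕ) (hp : p.Prime) [CharP k p]
    (u : k → Matrix.SpecialLinearGroup (Fin 3) k) (hu : IsGaMorphism u) :
    (p = 2 →
      (∀ v : k → Matrix.SpecialLinearGroup (Fin 3) k, HasFormCharTwo p v → IsFundamental v) ∧
      (IsFundamental u ↔
        ∃ v : k → Matrix.SpecialLinearGroup (Fin 3) k, HasFormCharTwo p v ∧ AreEquivalent u v)) ∧
    (3 ≤ p →
      (∀ v : k → Matrix.SpecialLinearGroup (Fin 3) k, HasFormCharOdd p v → IsFundamental v) ∧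
      (IsFundamental u ↔
        ∃ v : k → Matrix.SpecialLinearGroup (Fin 3) k, HasFormCharOdd p v ∧ AreEquivalent u v)) := by
  constructor
  · intro h
    have h2 : (2 : k) = 0 := by
      subst h
      exact_mod_cast CharP.cast_eq_zero k 2
    refine ⟨fun v hv => hv.isFundamental hp h2, fun hf => ?_, fun ⟨v, hv, huv⟩ =>
      (hv.isFundamental hp h2).of_areEquivalent huv⟩
    rcases hf.normal_forms hp with h | ⟨e, h | ⟨-, h | h⟩ | ⟨h, -⟩⟩
    · exact ⟨_, Or.inr (Or.inr (Or.inr fun _ => rfl)), h⟩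
    · exact ⟨_, Or.inl ⟨e, fun _ => rfl⟩, h⟩
    · exact ⟨_, Or.inr (Or.inl ⟨e, fun _ => rfl⟩), h⟩
    · exact ⟨_, Or.inr (Or.inr (Or.inl ⟨e, fun _ => rfl⟩)), h⟩
    · exact absurd h2 h
  · intro h
    have h2 : (2 : k) ≠ 0 := fun h0 => by
      have : p ∣ 2 := (CharP.cast_eq_zero_iff k p 2).mp (by exact_mod_cast h0)
      exact absurd (Nat.le_of_dvd (by norm_num) this) (by omega)
    refine ⟨fun v hv => hv.isFundamental hp h2, fun hf => ?_, fun ⟨v, hv, huv⟩ =>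
      (hv.isFundamental hp h2).of_areEquivalent huv⟩
    rcases hf.normal_forms hp with h | ⟨e, h | ⟨h, -⟩ | ⟨-, h⟩⟩
    · exact ⟨_, Or.inr (Or.inr fun _ => rfl), h⟩
    · exact ⟨_, Or.inr (Or.inl ⟨e, fun _ => rfl⟩), h⟩
    · exact absurd h h2
    · exact ⟨_, Or.inl ⟨e, fun _ => rfl⟩, h⟩
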